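/- Let $d\in\mathbb N$, let $\ell:\mathbb R\to[0,\infty)$ be continuous, let $W>0$, let $\mathcal D_X$ and $\mathcal D_Y$ be probability distributions on $\mathbb R^d$ and $\mathbb R$ with $\mathbb E\|X\|_1<\infty$ and $\mathbb E|Y|<\infty$ for $X\sim\mathcal D_X$, $Y\sim\mathcal D_Y$, and put $\mathcal D=\mathcal D_X\times\mathcal D_Y$. Let $$\mathcal F_W=\{(x,y)\mapsto \ell(\langle w,x\rangle-y)\;:\;w\in\mathbb R^d,\ \|w\|_2\le W\}.$$ Let $p\in(1,2]$ be such that $\mathcal F_W\subseteq L_p(\mathcal D)$, i.e. $\sup_{f\in\mathcal F_W}\mathbb E_{Z\sim\mathcal D}[|f(Z)|^p]<\infty$, write $\mu(f)=\mathbb E_{Z\sim\mathcal D}[f(Z)]$, and let $v_p<\infty$ be a real number with $v_p\ge\sup_{f\in\mathcal F_W}\mathbb E_{Z\sim\mathcal D}[|f(Z)-\mu(f)|^p]$. *Notation.* For $a\ge0$, $b>0$ let $\alpha_\ell(a,b)\in(0,\infty]$ be the largest $r$ such that $|\ell(x)-\ell(y)|\le b$ for all $x,y\in[-a,a]$ with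 $|x-y|\le r$ ($\alpha_\ell(a,b)=\infty$ if every $r$ has this property). Put $M=\mathbb E\|X\|_1+\mathbb E|Y|$ and, for $\varepsilon>0$ and $m\ge1$, $$J=\Big(\tfrac{3W}2+1\Big)3750\,M\,m,\qquad \beta(\varepsilon,m,\mathcal D)=\min\Big(\frac W2,\ \frac{\alpha_\ell(J,\varepsilon)}{3750\,M\,m}\Big),$$ where the quotient is read as $\infty$ if $\alpha_\ell(J,\varepsilon)=\infty$ or $M=0$. For $0<\delta<1$ put $$\kappa_0(\delta)=4\cdot1250^2\ln(e/\delta),\qquad N_{\mathcal D}(\varepsilon,m)=\Big(\frac{6W}{\beta(\varepsilon,m,\mathcal D)}\Big)^d .$$ Given three samples $Z_0,Z_1,Z_2$, each consisting of $\kappa$ blocks $Z_l^i=(Z_{l,1}^i,\dots,Z_{l,m}^i)$ of $m$ points, a set $G$ of real-valued functions is an $(\varepsilon,m)$-discretization of a class $\mathcal F$ on $Z_0,Z_1,Z_2$ if for each $f\in\mathcal F$ there are $\pi(f)\in G$ and $I_f\subseteq\{1,\dots,\kappa\}$ with $|I_f|\le 2\kappa/625$ such that $\sum_{j=1}^m\big|\frac{f(Z_{l,j}^i)-\pi(f)(Z_{l,j}^i)}m\big|\le\varepsilon$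 for all $i\notin I_f$ and $l\in\{0,1,2\}$. The class $\mathcal F$ admits a $\mathcal D$-discretization with threshold function $\kappa_0$, threshold $\varepsilon_0\in(0,\infty]$ and size function $N$ if for all $0<\varepsilon<\varepsilon_0$, $0<\delta<1$, $m\ge1$ and $\kappa\ge\kappa_0(\delta)$, with probability at least $1-\delta$ over independent $Z_0,Z_1,Z_2\sim(\mathcal D^m)^\kappa$, it admits an $(\varepsilon,m)$-discretization on $Z_0,Z_1,Z_2$ of size at most $N(\varepsilon,m)$. Finally, $\mathrm{MoM}(f,Z)$ for a sample $Z$ of $\kappa$ blocks of $m$ points is the median of the $\kappa$ block means $\frac1m\sum_{j=1}^m f(Z^i_j)$, where the median of $\kappa$ numbers is the $\frac{\kappa+1}2$-th smallest for odd $\kappa$ and the $\frac\kappa2$-th smallest for even $\kappa$. *Claim.* $\mathcal F_W$ admits a $\mathcal D$-discretization with threshold function $\kappa_0$, threshold $\varepsilon_0=\infty$ and size function $N_{\mathcal D}$. Moreover, for all $\varepsilon>0$, $\delta\in(0,1)$ and integers $m\ge1$ and $\kappa$ with $$m\ge\Big(\frac{400\cdot16^p\,v_p}{\varepsilon^p}\Big)^{\frac1{p-1}},\qquad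 \kappa\ge\max\Big\{\kappa_0(\delta/8),\ \frac{10^6\ln2}{99},\ 50\ln\frac{8N_{\mathcal D}(\varepsilon/16,m)}\delta\Big\},$$ it holds that $$\mathbb P_{Z\sim(\mathcal D^m)^\kappa}\Big(\sup_{f\in\mathcal F_W}|\mathrm{MoM}(f,Z)-\mu(f)|\le\varepsilon\Big)\ge1-\delta .$$ -/

import Mathlib

open MeasureTheory

namespace MedianOfMeans

noncomputable section

/-- The sample mean of `f` on a block of `m` points. -/
def sampleMean {𝒳 : Type*} {m : ℕ} (f : 𝒳 → ℝ) (x : Fin m → 𝒳) : ℝ :=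
  (∑ j, f (x j)) / m

/-- The (lower) median of `a₁, …, a_κ`. In ascending order `a₍₁₎ ≤ … ≤ a₍κ₎` it is `a₍(κ+1)/2₎` for
odd `κ` and `a₍κ/2₎` for even `κ`; counted from zero, this is the entry with index `(κ - 1) / 2`
(rounded down) in both cases. The value for `κ = 0` is a placeholder. -/
def median {κ : ℕ} (a : Fin κ → ℝ) : ℝ :=
  if h : 0 < κ then a (Tuple.sort a ⟨(κ - 1) / 2, by omega⟩) else 0

/-- The median-of-means estimator on `κ` blocks of `m` points each. -/
def mom {𝒳 : Type*} {m κ : ℕ} (f : 𝒳 → ℝ) (X : Fin κ → Fin m → 𝒳) : ℝ :=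
  median fun i => sampleMean f (X i)

/-- The law `(D^m)^κ` of `κ` independent blocks of `m` independent draws from `D`. -/
abbrev sampleLaw {𝒳 : Type*} [MeasurableSpace 𝒳] (D : Measure 𝒳) (m κ : ℕ) :
    Measure (Fin κ → Fin m → 𝒳) :=
  Measure.pi fun _ => Measure.pi fun _ => D

/-- The event `A` has probability at least `r` under `P`. As `A` is not assumed to be measurable, a
measurable part of `A` has to carry the probability (for measurable `A` this is `r ≤ P A`). -/
def ProbAtLeast {Ω : Type*} [MeasurableSpace Ω] (P : Measure Ω) (r : ℝ) (A : Set Ω) : Prop :=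
  ∃ B ⊆ A, MeasurableSet B ∧ ENNReal.ofReal r ≤ P B

/-- `ℱ ⊆ L_p(D)` with uniformly bounded `p`-th moments. -/
def SubsetLp {𝒳 : Type*} [MeasurableSpace 𝒳] (ℱ : Set (𝒳 → ℝ)) (p : ℝ) (D : Measure 𝒳) : Prop :=
  (∀ f ∈ ℱ, AEStronglyMeasurable f D) ∧
    ⨆ f ∈ ℱ, ∫⁻ z, ENNReal.ofReal (|f z| ^ p) ∂D < ⊤

/-- `G` is an `(ε, m)`-discretization of `ℱ` on the three samples `X 0`, `X 1`, `X 2`. -/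
def IsDiscretization {𝒳 : Type*} {m κ : ℕ} (ℱ : Set (𝒳 → ℝ)) (ε : ℝ)
    (X : Fin 3 → Fin κ → Fin m → 𝒳) (G : Set (𝒳 → ℝ)) : Prop :=
  ∀ f ∈ ℱ, ∃ g ∈ G, ∃ I : Finset (Fin κ), (I.card : ℝ) ≤ 2 * κ / 625 ∧
    ∀ i ∉ I, ∀ l : Fin 3, ∑ j, |(f (X l i j) - g (X l i j)) / m| ≤ ε

/-- `ℱ` admits a `D`-discretization with threshold function `κ₀`, threshold `ε₀` and size
function `N`. -/
def AdmitsDiscretization {𝒳 : Type*} [MeasurableSpace 𝒳] (ℱ : Set (𝒳 → ℝ)) (D : Measure 𝒳)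
    (κ₀ : ℝ → ℝ) (ε₀ : ENNReal) (N : ℝ → ℕ → ℝ) : Prop :=
  0 < ε₀ ∧ ∀ (ε δ : ℝ) (m κ : ℕ), 0 < ε → ENNReal.ofReal ε < ε₀ → 0 < δ → δ < 1 → 1 ≤ m →
    κ₀ δ ≤ κ →
    ProbAtLeast (Measure.pi fun _ : Fin 3 => sampleLaw D m κ) (1 - δ)
      {X | ∃ G : Set (𝒳 → ℝ), IsDiscretization ℱ ε X G ∧ G.Finite ∧ (G.ncard : ℝ) ≤ N ε m}

/-- The class of the functions `(x, y) ↦ ℓ (⟨w, x⟩ - y)` with `‖w‖ ≤ W`. -/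
def regressionClass {d : ℕ} (ℓ : ℝ → ℝ) (W : ℝ) : Set (EuclideanSpace ℝ (Fin d) × ℝ → ℝ) :=
  {f | ∃ w : EuclideanSpace ℝ (Fin d), ‖w‖ ≤ W ∧ f = fun z => ℓ (inner ℝ w z.1 - z.2)}

/-- The largest `r` such that `|ℓ x - ℓ y| ≤ b` for all `x, y ∈ [-a, a]` with `|x - y| ≤ r`. It
is `⊤` if every `r` has this property. -/
def modulus (ℓ : ℝ → ℝ) (a b : ℝ) : ENNReal :=
  sSup {r | ∀ x ∈ Set.Icc (-a) a, ∀ y ∈ Set.Icc (-a) a,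
    ENNReal.ofReal |x - y| ≤ r → |ℓ x - ℓ y| ≤ b}

/-- `E ‖X‖₁ + E |Y|`. -/
def firstMoment {d : ℕ} (DX : Measure (EuclideanSpace ℝ (Fin d))) (DY : Measure ℝ) : ℝ :=
  (∫ x, ∑ i, |x i| ∂DX) + ∫ y, |y| ∂DY

/-- `J = (3 W / 2 + 1) · 3750 (E ‖X‖₁ + E |Y|) m`. -/
def radius {d : ℕ} (DX : Measure (EuclideanSpace ℝ (Fin d))) (DY : Measure ℝ) (W : ℝ) (m : ℕ) :
    ℝ :=
  (3 * W / 2 + 1) * (3750 * firstMoment DX DY * m)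

/-- `β(ε, m, D) = min (W / 2, α(J, ε) / (3750 (E ‖X‖₁ + E |Y|) m))`. The quotient is taken in
`[0, ∞]`: it is `∞` where `α(J, ε) = ∞` or the denominator vanishes, and then `β = W / 2`. -/
def netScale {d : ℕ} (ℓ : ℝ → ℝ) (DX : Measure (EuclideanSpace ℝ (Fin d))) (DY : Measure ℝ)
    (W ε : ℝ) (m : ℕ) : ℝ :=
  (min (ENNReal.ofReal (W / 2))
    (modulus ℓ (radius DX DY W m) ε / ENNReal.ofReal (3750 * firstMoment DX DY * m))).toReal

/-- The size function `N(ε, m) = (6 W / β(ε, m, D)) ^ d`. -/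
def sizeBound {d : ℕ} (ℓ : ℝ → ℝ) (DX : Measure (EuclideanSpace ℝ (Fin d))) (DY : Measure ℝ)
    (W ε : ℝ) (m : ℕ) : ℝ :=
  (6 * W / netScale ℓ DX DY W ε m) ^ d

/-- The threshold function `κ₀(δ) = 4 · 1250² ln (e / δ)`. -/
def threshold (δ : ℝ) : ℝ := 4 * 1250 ^ 2 * Real.log (Real.exp 1 / δ)

end

end MedianOfMeans

/-!
The class is approximated by a finite subclass that does not depend on the sample. Call a block
heavy if the sizes `‖x‖₁ + |y|` of its points add up to more than `3750 M m`, where `M` is the first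
moment. By Markov's inequality a block is heavy with probability at most `1 / 3750`
(`measureReal_heavyBlocks_le`). On every other block all residuals `⟨w, x⟩ - y` with `‖w‖ ≤ W` lie in
`[-J, J]`, and moving `w` by `β` moves a residual by at most `α(J, ε)`, hence the loss by at most
`ε`. So the functions given by an internal `β`-net of the ball of radius `W` approximate the class
on all blocks that are not heavy (`exists_finite_approximation`), and by a volume comparison such a
net needs at most `(2 W / β + 1) ^ d ≤ (6 W / β) ^ d` points (`exists_net`). A Chernoff bound
(`measureReal_le_card_le_exp`) controls the number of heavy blocks, which is the discretization
property.

For the median of means, the weak law under a `p`-th moment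
(`measureReal_sampleMean_deviation_le`, proved by truncation) shows that for a fixed function of the
class a block mean is off by more than `ε / 16` with probability at most `3 / 400`. By Chernoff's
bound and a union bound over the finite subclass, with high probability each `g` in it has fewer
than `2 κ / 5` such blocks, and fewer than `2 κ / 1875` blocks are heavy. If `g` approximates `f`,
then the expectations of `f` and `g` differ by at most `3 ε / 16`, because some block is not heavy
and represents both well (`abs_integral_sub_integral_le`). So more than half of the block means of
`f` are within `5 ε / 16` of its expectation, and therefore also their median
(`abs_median_sub_le`). The good event depends on the finite subclass only, so that no measurability
of a supremum over the class is needed.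
-/

open MeasureTheory

namespace MedianOfMeans

/-! ### Nets of balls -/

/-- The closed ball of radius `W` has an internal `β`-net of at most `(2 W / β + 1) ^ dim`
points. -/
theorem exists_net {E : Type*} [NormedAddCommGroup E] [NormedSpace ℝ E] [FiniteDimensional ℝ E]
    {W β : ℝ} (hW : 0 < W) (hβ : 0 < β) :
    ∃ s : Finset E, (∀ c ∈ s, ‖c‖ ≤ W) ∧ (∀ w, ‖w‖ ≤ W → ∃ c ∈ s, ‖w - c‖ ≤ β) ∧
      (s.card : ℝ) ≤ (2 * W / β + 1) ^ Module.finrank ℝ E := by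
  classical
  borelize E
  let μ : Measure E := Measure.addHaar
  have hρ : 0 < W + β / 2 := by positivity
  -- Balls of radius `β / 2` around `β`-separated points are disjoint, so volumes can be compared.
  have hcard : ∀ s : Finset E, (∀ c ∈ s, ‖c‖ ≤ W) →
      (∀ c ∈ s, ∀ d ∈ s, c ≠ d → β < ‖c - d‖) →
      (s.card : ℝ) ≤ (2 * W / β + 1) ^ Module.finrank ℝ E := by
    intro s hs hsep
    have hdisj : Set.PairwiseDisjoint (s : Set E) fun c => Metric.ball c (β / 2) := by
      intro c hc d hd hcd
      apply Metric.ball_disjoint_ball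
      rw [dist_eq_norm]
      linarith [hsep c hc d hd hcd]
    have hsub : (⋃ c ∈ s, Metric.ball c (β / 2)) ⊆ Metric.ball (0 : E) (W + β / 2) := by
      refine Set.iUnion₂_subset fun c hc => Metric.ball_subset_ball' ?_
      rw [dist_zero_right]
      linarith [hs c hc]
    have hvol := measure_mono (μ := μ) hsub
    rw [measure_biUnion_finset hdisj fun c _ => measurableSet_ball] at hvol
    simp only [μ.addHaar_ball_of_pos _ (half_pos hβ), μ.addHaar_ball_of_pos _ hρ,
      Finset.sum_const, nsmul_eq_mul, ← mul_assoc] at hvol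
    have hvol' := (ENNReal.mul_le_mul_iff_left
      (Metric.measure_ball_pos μ (0 : E) zero_lt_one).ne' measure_ball_lt_top.ne).1 hvol
    have h := ENNReal.toReal_le_of_le_ofReal (by positivity) hvol'
    rw [ENNReal.toReal_mul, ENNReal.toReal_ofReal (by positivity), ENNReal.toReal_natCast,
      ← le_div_iff₀ (by positivity), ← div_pow] at h
    have hbase : 2 * W / β + 1 = (W + β / 2) / (β / 2) := by field_simp
    rwa [hbase]
  by_contra! hcon
  have hall : ∀ n : ℕ, ∃ s : Finset E, (∀ c ∈ s, ‖c‖ ≤ W) ∧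
      (∀ c ∈ s, ∀ d ∈ s, c ≠ d → β < ‖c - d‖) ∧ s.card = n := by
    intro n
    induction n with
    | zero => exact ⟨∅, by simp⟩
    | succ n ih =>
      obtain ⟨s, hs, hsep, rfl⟩ := ih
      obtain ⟨w, hw, hwfar⟩ : ∃ w, ‖w‖ ≤ W ∧ ∀ c ∈ s, β < ‖w - c‖ := by
        by_contra! h
        exact absurd (hcard s hs hsep) (not_le.2 (hcon s hs h))
      have hws : w ∉ s := fun h => by
        have := hwfar w h
        simp only [sub_self, norm_zero] at this
        linarith
      refine ⟨insert w s, ?_, ?_, Finset.card_insert_of_notMem hws⟩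
      · simpa using ⟨hw, hs⟩
      · intro c hc d hd hcd
        rcases Finset.mem_insert.1 hc with hc' | hc' <;> rcases Finset.mem_insert.1 hd with hd' | hd'
        · exact absurd (hc'.trans hd'.symm) hcd
        · exact hc' ▸ hwfar d hd'
        · rw [norm_sub_rev]; exact hd' ▸ hwfar c hc'
        · exact hsep c hc' d hd' hcd
  obtain ⟨n, hn⟩ := exists_nat_gt ((2 * W / β + 1) ^ Module.finrank ℝ E)
  obtain ⟨s, hs, hsep, rfl⟩ := hall n
  exact absurd (hcard s hs hsep) (not_le.2 hn)

/-! ### The median -/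

/-- Fewer than half of the entries cannot move the median out of the interval that contains the
others. -/
theorem abs_median_sub_le {κ : ℕ} (hκ : 0 < κ) (a : Fin κ → ℝ) (μ ε : ℝ) (S : Finset (Fin κ))
    (hS : 2 * S.card < κ) (h : ∀ i ∉ S, |a i - μ| ≤ ε) : |median a - μ| ≤ ε := by
  classical
  rw [median, dif_pos hκ]
  set k : Fin κ := ⟨(κ - 1) / 2, by omega⟩ with hk
  set σ := Tuple.sort a
  have hmono : Monotone (a ∘ σ) := Tuple.monotone_sort a
  -- A set of more than `#S` positions in the sorted order contains a good one.
  have key : ∀ T : Finset (Fin κ), S.card < T.card → ∃ i ∈ T, |a (σ i) - μ| ≤ ε := by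
    intro T hT
    by_contra! hcon
    have hsub : T.map σ.toEmbedding ⊆ S := by
      intro j hj
      obtain ⟨i, hi, rfl⟩ := Finset.mem_map.1 hj
      by_contra hjS
      exact absurd (h _ hjS) (not_le.2 (hcon i hi))
    have := Finset.card_le_card hsub
    rw [Finset.card_map] at this
    omega
  obtain ⟨i, hi, hai⟩ := key (Finset.Iic k) (by rw [Fin.card_Iic]; simp only [hk]; omega)
  obtain ⟨j, hj, haj⟩ := key (Finset.Ici k) (by rw [Fin.card_Ici]; simp only [hk]; omega)
  have h1 : a (σ i) ≤ a (σ k) := hmono (Finset.mem_Iic.1 hi)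
  have h2 : a (σ k) ≤ a (σ j) := hmono (Finset.mem_Ici.1 hj)
  rw [abs_le] at *
  constructor <;> linarith [hai.1, haj.2]

/-! ### Sums of independent variables -/

open Classical in
/-- Chernoff's bound, from the exponential moment `E exp (1_S) ≤ exp (2 q)`, for the number of coordinates that fall into
a set of probability at most `q`. -/
theorem measureReal_le_card_le_exp {Ω : Type*} [MeasurableSpace Ω] (P : Measure Ω)
    [IsProbabilityMeasure P] {S : Set Ω} (hS : MeasurableSet S) {q : ℝ} (hq : P.real S ≤ q)
    (κ : ℕ) (c : ℝ) :
    (Measure.pi fun _ : Fin κ => P).real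
        {ω | c ≤ ((Finset.univ.filter fun i => ω i ∈ S).card : ℝ)} ≤
      Real.exp (κ * (2 * q) - c) := by
  let φ : Ω → ℝ := fun ω => Real.exp (S.indicator 1 ω)
  have hφ : ∀ ω, φ ω = 1 + S.indicator (fun _ => Real.exp 1 - 1) ω := by
    intro ω
    by_cases h : ω ∈ S <;> simp [φ, h]
  have hcard : ∀ ω : Fin κ → Ω,
      Real.exp ((Finset.univ.filter fun i => ω i ∈ S).card : ℝ) = ∏ i, φ (ω i) := by
    intro ω
    rw [← Real.exp_sum]
    congr 1
    rw [Finset.card_filter]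
    push_cast
    exact Finset.sum_congr rfl fun i _ => by by_cases h : ω i ∈ S <;> simp [h]
  have hφint : Integrable φ P := by
    rw [funext hφ]
    exact (integrable_const _).add ((integrable_const _).indicator hS)
  have hint : Integrable (fun ω : Fin κ → Ω => ∏ i, φ (ω i)) (Measure.pi fun _ => P) :=
    Integrable.fintype_prod fun _ => hφint
  have hone : ∫ ω, φ ω ∂P ≤ Real.exp (2 * q) := by
    have : ∫ ω, φ ω ∂P = 1 + P.real S * (Real.exp 1 - 1) := by
      simp_rw [hφ]
      rw [integral_add (integrable_const _) ((integrable_const _).indicator hS),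
        integral_indicator_const _ hS]
      simp
    rw [this]
    have h0 : 0 ≤ P.real S := measureReal_nonneg
    have he : Real.exp 1 - 1 ≤ 2 := by linarith [Real.exp_one_lt_d9]
    have : P.real S * (Real.exp 1 - 1) ≤ 2 * q := by nlinarith
    linarith [Real.add_one_le_exp (2 * q)]
  have hmarkov := mul_meas_ge_le_integral_of_nonneg (f := fun ω : Fin κ → Ω => ∏ i, φ (ω i))
    (Filter.Eventually.of_forall fun ω => Finset.prod_nonneg fun i _ => (Real.exp_pos _).le)
    hint (Real.exp c)
  rw [integral_fintype_prod_eq_pow, Fintype.card_fin] at hmarkov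
  have hset : {ω : Fin κ → Ω | c ≤ ((Finset.univ.filter fun i => ω i ∈ S).card : ℝ)} =
      {ω | Real.exp c ≤ ∏ i, φ (ω i)} := by
    ext ω
    simp only [Set.mem_ofPred_eq]
    rw [← hcard, Real.exp_le_exp]
  rw [hset, Real.exp_sub, le_div_iff₀ (Real.exp_pos _), mul_comm]
  refine hmarkov.trans ?_
  rw [Real.exp_nat_mul]
  exact pow_le_pow_left₀ (integral_nonneg fun ω => (Real.exp_pos _).le) hone κ

/-- A weak law of large numbers under a central `p`-th moment, `1 < p ≤ 2`. Truncating `f - E f` at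
`t m` costs probability `ρ`, shifts the sum by at most `ρ t m`, and leaves a variance of at most
`ρ (t m)²`. -/
theorem measureReal_sampleMean_deviation_le {𝒳 : Type*} [MeasurableSpace 𝒳] (P : Measure 𝒳)
    [IsProbabilityMeasure P] {f : 𝒳 → ℝ} (hf : Measurable f) (hfint : Integrable f P)
    {p v t ρ : ℝ} {m : ℕ} (hp1 : 1 < p) (hp2 : p ≤ 2)
    (hpint : Integrable (fun z => |f z - ∫ z', f z' ∂P| ^ p) P)
    (hv : ∫ z, |f z - ∫ z', f z' ∂P| ^ p ∂P ≤ v) (ht : 0 < t) (hm : 1 ≤ m)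
    (hρ1 : ρ ≤ 1) (hρ : v ≤ ρ * (t ^ p * (m : ℝ) ^ (p - 1))) :
    (Measure.pi fun _ : Fin m => P).real {x | t < |sampleMean f x - ∫ z, f z ∂P|} ≤ 3 * ρ := by
  set μ := ∫ z, f z ∂P with hμ
  have hm0 : (0 : ℝ) < m := by exact_mod_cast hm
  set T : ℝ := t * m with hT
  have hT0 : 0 < T := by positivity
  set A : ℝ := ∫ z, |f z - μ| ^ p ∂P with hA
  have hA0 : 0 ≤ A := integral_nonneg fun z => by positivity
  have hTA : m * A ≤ ρ * T ^ p := by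
    have : T ^ p = (t ^ p * (m : ℝ) ^ (p - 1)) * m := by
      rw [hT, Real.mul_rpow ht.le hm0.le, Real.rpow_sub_one hm0.ne']
      field_simp
    rw [this]
    nlinarith [hv.trans hρ]
  have hρ0 : 0 ≤ ρ := by
    by_contra h
    have : ρ * T ^ p < 0 := mul_neg_of_neg_of_pos (not_le.1 h) (by positivity)
    nlinarith [mul_nonneg hm0.le hA0]
  set g : 𝒳 → ℝ := fun z => f z - μ with hg
  have hgm : Measurable g := hf.sub_const μ
  have hgint : Integrable g P := hfint.sub (integrable_const μ)
  have hg0 : ∫ z, g z ∂P = 0 := by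
    rw [hg, integral_sub hfint (integrable_const μ)]
    simp [hμ]
  set L : Set 𝒳 := {z | T < |g z|}
  have hLm : MeasurableSet L := measurableSet_lt measurable_const hgm.abs
  set Y : 𝒳 → ℝ := Lᶜ.indicator g
  have hYm : Measurable Y := hgm.indicator hLm.compl
  have hYT : ∀ z, |Y z| ≤ T := by
    intro z
    by_cases h : z ∈ L
    · simp [Y, h, hT0.le]
    · simpa [Y, h] using not_lt.1 h
  have hYp : MemLp Y 2 P := by
    refine MemLp.of_bound hYm.aestronglyMeasurable T (Filter.Eventually.of_forall fun z => ?_)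
    exact hYT z
  -- Large values are rare.
  have hLP : m * P.real L ≤ ρ := by
    have h1 := mul_meas_ge_le_integral_of_nonneg (μ := P) (f := fun z => |g z| ^ p)
      (Filter.Eventually.of_forall fun z => by positivity) hpint (T ^ p)
    have h2 : P.real L ≤ P.real {z | T ^ p ≤ |g z| ^ p} :=
      measureReal_mono fun z hz => Real.rpow_le_rpow hT0.le (le_of_lt hz) (by linarith)
    have hTp : 0 < T ^ p := by positivity
    have h3 : T ^ p * P.real L ≤ A := (mul_le_mul_of_nonneg_left h2 hTp.le).trans h1
    have h4 : T ^ p * (m * P.real L) ≤ T ^ p * ρ := by nlinarith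
    exact le_of_mul_le_mul_left h4 hTp
  -- The truncated variable is nearly centred.
  have hYmean : m * |∫ z, Y z ∂P| ≤ ρ * T := by
    have h1 : ∫ z, Y z ∂P = - ∫ z, L.indicator g z ∂P := by
      have h := integral_add (hgint.indicator hLm) (hgint.indicator hLm.compl)
      have h' : ∀ z, L.indicator g z + Lᶜ.indicator g z = g z := fun z =>
        congrFun (Set.indicator_self_add_compl L g) z
      simp_rw [h', hg0] at h
      linarith
    have h2 : ∀ z, |L.indicator g z| ≤ |g z| ^ p * T ^ (1 - p) := by
      intro z
      by_cases h : z ∈ L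
      · have hz : T < |g z| := h
        have hz0 : 0 < |g z| := hT0.trans hz
        have : |g z| = |g z| ^ p * |g z| ^ (1 - p) := by
          rw [← Real.rpow_add hz0]; simp
        rw [Set.indicator_of_mem h]
        calc |g z| = |g z| ^ p * |g z| ^ (1 - p) := this
          _ ≤ _ := mul_le_mul_of_nonneg_left
            (Real.rpow_le_rpow_of_nonpos hT0 hz.le (by linarith)) (by positivity)
      · rw [Set.indicator_of_notMem h, abs_zero]; positivity
    have h3 : |∫ z, L.indicator g z ∂P| ≤ A * T ^ (1 - p) := by
      refine (abs_integral_le_integral_abs).trans ?_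
      rw [hA, ← integral_mul_const]
      exact integral_mono (hgint.indicator hLm).abs (hpint.mul_const _) h2
    rw [h1, abs_neg]
    calc m * |∫ z, L.indicator g z ∂P| ≤ m * (A * T ^ (1 - p)) := by gcongr
      _ = (m * A) * T ^ (1 - p) := by ring
      _ ≤ (ρ * T ^ p) * T ^ (1 - p) := by gcongr
      _ = ρ * T := by rw [mul_assoc, ← Real.rpow_add hT0]; simp
  have hYsq : m * ∫ z, Y z ^ 2 ∂P ≤ ρ * T ^ 2 := by
    have h2 : ∀ z, Y z ^ 2 ≤ |g z| ^ p * T ^ (2 - p) := by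
      intro z
      by_cases h : z ∈ L
      · simp only [Y, Set.indicator_of_notMem (show z ∉ Lᶜ from fun h' => h' h),
          zero_pow two_ne_zero]
        positivity
      · have hz : |g z| ≤ T := not_lt.1 h
        simp only [Y, Set.indicator_of_mem (show z ∈ Lᶜ from h)]
        rcases (abs_nonneg (g z)).eq_or_lt with hz0 | hz0
        · rw [← sq_abs, ← hz0, zero_pow two_ne_zero]; positivity
        · calc g z ^ 2 = |g z| ^ (2 : ℝ) := by rw [Real.rpow_two, sq_abs]
            _ = |g z| ^ p * |g z| ^ (2 - p) := by rw [← Real.rpow_add hz0]; ring_nf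
            _ ≤ _ := mul_le_mul_of_nonneg_left
              (Real.rpow_le_rpow hz0.le hz (by linarith)) (by positivity)
    have h3 : ∫ z, Y z ^ 2 ∂P ≤ A * T ^ (2 - p) := by
      rw [hA, ← integral_mul_const]
      exact integral_mono hYp.integrable_sq (hpint.mul_const _) h2
    calc m * ∫ z, Y z ^ 2 ∂P ≤ m * (A * T ^ (2 - p)) := by gcongr
      _ = (m * A) * T ^ (2 - p) := by ring
      _ ≤ (ρ * T ^ p) * T ^ (2 - p) := by gcongr
      _ = ρ * T ^ 2 := by
        rw [mul_assoc, ← Real.rpow_add hT0, add_sub_cancel, Real.rpow_two]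
  set Q : Measure (Fin m → 𝒳) := Measure.pi fun _ => P with hQ
  set R : (Fin m → 𝒳) → ℝ := ∑ j, fun x => Y (x j) with hR
  have hcoord : ∀ j : Fin m, MemLp (fun x : Fin m → 𝒳 => Y (x j)) 2 Q := fun j =>
    hYp.comp_measurePreserving (measurePreserving_eval (fun _ => P) j)
  have hRp : MemLp R 2 Q := memLp_finsetSum' _ fun j _ => hcoord j
  have hRmean : ∫ x, R x ∂Q = m * ∫ z, Y z ∂P := by
    have : ∀ j : Fin m, ∫ x, Y (x j) ∂Q = ∫ z, Y z ∂P := fun j => by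
      have h := (measurePreserving_eval (fun _ : Fin m => P) j)
      rw [← h.map_eq, integral_map h.measurable.aemeasurable hYm.aestronglyMeasurable]
    simp only [hR, Finset.sum_apply]
    rw [integral_finsetSum _ fun j _ => (hcoord j).integrable one_le_two]
    simp [this]
  have hRvar : ProbabilityTheory.variance R Q ≤ ρ * T ^ 2 := by
    rw [hR, hQ, ProbabilityTheory.variance_sum_pi (X := fun _ => Y) fun _ => hYp]
    simp only [Finset.sum_const, Finset.card_univ, Fintype.card_fin, nsmul_eq_mul]
    refine le_trans ?_ hYsq
    gcongr
    rw [ProbabilityTheory.variance_eq_sub hYp]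
    simp only [Pi.pow_apply]
    linarith [sq_nonneg (∫ z, Y z ∂P)]
  have hRsq : ∫ x, R x ^ 2 ∂Q ≤ 2 * ρ * T ^ 2 := by
    have h := ProbabilityTheory.variance_eq_sub hRp
    simp only [Pi.pow_apply] at h
    have h2 : (∫ x, R x ∂Q) ^ 2 ≤ ρ * T ^ 2 := by
      rw [hRmean, ← sq_abs, abs_mul, abs_of_pos hm0]
      have : (m * |∫ z, Y z ∂P|) ^ 2 ≤ (ρ * T) ^ 2 :=
        pow_le_pow_left₀ (by positivity) hYmean 2
      nlinarith [mul_nonneg hρ0 (sq_nonneg T)]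
    linarith
  have hRP : Q.real {x | T ^ 2 ≤ R x ^ 2} ≤ 2 * ρ := by
    have h := mul_meas_ge_le_integral_of_nonneg (μ := Q) (f := fun x => R x ^ 2)
      (Filter.Eventually.of_forall fun x => sq_nonneg _) hRp.integrable_sq (T ^ 2)
    have hT2 : 0 < T ^ 2 := by positivity
    have h4 : T ^ 2 * Q.real {x | T ^ 2 ≤ R x ^ 2} ≤ T ^ 2 * (2 * ρ) := by linarith
    exact le_of_mul_le_mul_left h4 hT2
  have hsub : {x | t < |sampleMean f x - μ|} ⊆
      (⋃ j : Fin m, (Function.eval j) ⁻¹' L) ∪ {x | T ^ 2 ≤ R x ^ 2} := by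
    intro x hx
    by_contra hcon
    simp only [Set.mem_union, Set.mem_iUnion, Set.mem_preimage, Function.eval, not_or,
      not_exists, Set.mem_ofPred_eq, not_le] at hcon
    have hsum : m * (sampleMean f x - μ) = R x := by
      have : ∀ j, Y (x j) = f (x j) - μ := fun j =>
        Set.indicator_of_mem (show x j ∈ Lᶜ from hcon.1 j) g
      simp only [hR, Finset.sum_apply, this, sampleMean, Finset.sum_sub_distrib,
        Finset.sum_const, Finset.card_univ, Fintype.card_fin, nsmul_eq_mul]
      field_simp
    have h1 : |R x| < T := abs_lt_of_sq_lt_sq hcon.2 hT0.le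
    rw [← hsum, abs_mul, abs_of_pos hm0] at h1
    have h2 : t < |sampleMean f x - μ| := hx
    nlinarith
  have hcoordP : ∀ j : Fin m, Q.real ((Function.eval j) ⁻¹' L) = P.real L := fun j =>
    (measurePreserving_eval (fun _ : Fin m => P) j).measureReal_preimage hLm.nullMeasurableSet
  calc Q.real {x | t < |sampleMean f x - μ|}
      ≤ Q.real (⋃ j : Fin m, (Function.eval j) ⁻¹' L) + Q.real {x | T ^ 2 ≤ R x ^ 2} :=
        (measureReal_mono hsub).trans (measureReal_union_le _ _)
    _ ≤ (∑ j : Fin m, Q.real ((Function.eval j) ⁻¹' L)) + 2 * ρ :=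
        add_le_add (measureReal_iUnion_fintype_le _) hRP
    _ = m * P.real L + 2 * ρ := by simp [hcoordP]
    _ ≤ 3 * ρ := by linarith

/-! ### The modulus of continuity and the scale of the net -/

/-- The supremum in `modulus` is attained, because `ℓ` is continuous. -/
theorem abs_sub_le_of_le_modulus {ℓ : ℝ → ℝ} (hℓ : Continuous ℓ) {a b x y : ℝ} (hb : 0 ≤ b)
    (hx : x ∈ Set.Icc (-a) a) (hy : y ∈ Set.Icc (-a) a)
    (hxy : ENNReal.ofReal |x - y| ≤ modulus ℓ a b) : |ℓ x - ℓ y| ≤ b := by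
  rcases eq_or_ne x y with rfl | hne
  · simpa using hb
  have hpos : 0 < |x - y| := abs_pos.2 (sub_ne_zero.2 hne)
  -- Points strictly closer to `x` on the segment towards `y` satisfy the bound; let them tend to `y`.
  have hcont : Continuous fun s : ℝ => |ℓ x - ℓ (x + s * (y - x))| := by fun_prop
  have hlim : Filter.Tendsto (fun s : ℝ => |ℓ x - ℓ (x + s * (y - x))|)
      (nhdsWithin 1 (Set.Iio 1)) (nhds |ℓ x - ℓ y|) := by
    have h := (hcont.tendsto 1).mono_left (nhdsWithin_le_nhds (s := Set.Iio 1))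
    simpa using h
  refine le_of_tendsto hlim ?_
  filter_upwards [Ioo_mem_nhdsLT (zero_lt_one' ℝ)] with s hs
  have hdist : |x - (x + s * (y - x))| = s * |x - y| := by
    rw [show x - (x + s * (y - x)) = s * (x - y) by ring, abs_mul, abs_of_pos hs.1]
  have hlt : ENNReal.ofReal |x - (x + s * (y - x))| < modulus ℓ a b := by
    refine lt_of_lt_of_le ?_ hxy
    rw [hdist, ENNReal.ofReal_lt_ofReal_iff hpos]
    exact mul_lt_of_lt_one_left hpos hs.2
  obtain ⟨r, hr, hlt⟩ := lt_sSup_iff.1 hlt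
  refine hr x hx _ ?_ hlt.le
  have := (convex_Icc (-a) a) hx hy (sub_nonneg.2 hs.2.le) hs.1.le (by ring)
  convert this using 1
  simp only [smul_eq_mul]
  ring

theorem modulus_pos {ℓ : ℝ → ℝ} (hℓ : Continuous ℓ) (a : ℝ) {b : ℝ} (hb : 0 < b) :
    0 < modulus ℓ a b := by
  have h := (isCompact_Icc (a := -a) (b := a)).uniformContinuousOn_of_continuous hℓ.continuousOn
  obtain ⟨r, hr, h⟩ := Metric.uniformContinuousOn_iff.1 h b hb
  refine lt_of_lt_of_le (ENNReal.ofReal_pos.2 (half_pos hr)) (le_sSup fun x hx y hy hxy => ?_)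
  rw [ENNReal.ofReal_le_ofReal_iff (half_pos hr).le] at hxy
  exact (h x hx y hy (by rw [Real.dist_eq]; linarith)).le

section netScale

variable {d : ℕ} {ℓ : ℝ → ℝ} (DX : Measure (EuclideanSpace ℝ (Fin d))) (DY : Measure ℝ)
  {W ε : ℝ} (m : ℕ)

theorem ofReal_netScale :
    ENNReal.ofReal (netScale ℓ DX DY W ε m) = min (ENNReal.ofReal (W / 2))
      (modulus ℓ (radius DX DY W m) ε / ENNReal.ofReal (3750 * firstMoment DX DY * m)) :=
  ENNReal.ofReal_toReal (ne_top_of_le_ne_top ENNReal.ofReal_ne_top (min_le_left _ _))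

theorem netScale_le (hW : 0 < W) : netScale ℓ DX DY W ε m ≤ W / 2 := by
  rw [← ENNReal.ofReal_le_ofReal_iff (by positivity), ofReal_netScale]
  exact min_le_left _ _

theorem netScale_pos (hℓ : Continuous ℓ) (hW : 0 < W) (hε : 0 < ε) :
    0 < netScale ℓ DX DY W ε m := by
  rw [← ENNReal.ofReal_pos, ofReal_netScale, lt_min_iff]
  exact ⟨ENNReal.ofReal_pos.2 (half_pos hW),
    ENNReal.div_pos (modulus_pos hℓ _ hε).ne' ENNReal.ofReal_ne_top⟩

theorem netScale_nonneg : 0 ≤ netScale ℓ DX DY W ε m := ENNReal.toReal_nonneg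

/-- Also true if the first moment vanishes or the modulus is infinite. -/
theorem ofReal_netScale_mul_le (ℓ : ℝ → ℝ) (W ε : ℝ) :
    ENNReal.ofReal (netScale ℓ DX DY W ε m * (3750 * firstMoment DX DY * m)) ≤
      modulus ℓ (radius DX DY W m) ε := by
  rw [ENNReal.ofReal_mul (netScale_nonneg DX DY m)]
  refine ENNReal.mul_le_of_le_div ?_
  rw [ofReal_netScale]
  exact min_le_right _ _

end netScale

theorem firstMoment_nonneg {d : ℕ} (DX : Measure (EuclideanSpace ℝ (Fin d))) (DY : Measure ℝ) :
    0 ≤ firstMoment DX DY :=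
  add_nonneg (integral_nonneg fun _ => Finset.sum_nonneg fun _ _ => abs_nonneg _)
    (integral_nonneg fun _ => abs_nonneg _)

theorem norm_le_sum_abs {d : ℕ} (x : EuclideanSpace ℝ (Fin d)) : ‖x‖ ≤ ∑ i, |x i| := by
  rw [EuclideanSpace.norm_eq, Real.sqrt_le_left (Finset.sum_nonneg fun _ _ => abs_nonneg _)]
  exact Finset.sum_sq_le_sq_sum_of_nonneg fun _ _ => abs_nonneg _

/-! ### Heavy blocks and the finite approximating class -/

/-- The `ℓ¹`-size `‖x‖₁ + |y|` of a data point `(x, y)`. -/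
def pointSize {d : ℕ} (z : EuclideanSpace ℝ (Fin d) × ℝ) : ℝ := (∑ i, |z.1 i|) + |z.2|

theorem pointSize_nonneg {d : ℕ} (z : EuclideanSpace ℝ (Fin d) × ℝ) : 0 ≤ pointSize z :=
  add_nonneg (Finset.sum_nonneg fun _ _ => abs_nonneg _) (abs_nonneg _)

theorem measurable_pointSize {d : ℕ} :
    Measurable (pointSize : EuclideanSpace ℝ (Fin d) × ℝ → ℝ) := by
  have : Continuous (pointSize : EuclideanSpace ℝ (Fin d) × ℝ → ℝ) := by
    unfold pointSize
    fun_prop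
  exact this.measurable

/-- The points of size at most `3750 M m`, where `M` is the first moment, have residuals in the
interval `[-J, J]` on which the modulus is taken. -/
theorem abs_regression_sub_le {d : ℕ} {ℓ : ℝ → ℝ} (hℓ : Continuous ℓ)
    (DX : Measure (EuclideanSpace ℝ (Fin d))) (DY : Measure ℝ) {W ε : ℝ} {m : ℕ}
    (hW : 0 < W) (hε : 0 ≤ ε) {w c : EuclideanSpace ℝ (Fin d)} (hw : ‖w‖ ≤ W) (hc : ‖c‖ ≤ W)
    (hwc : ‖w - c‖ ≤ netScale ℓ DX DY W ε m) {z : EuclideanSpace ℝ (Fin d) × ℝ}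
    (hz : pointSize z ≤ 3750 * firstMoment DX DY * m) :
    |ℓ (inner ℝ w z.1 - z.2) - ℓ (inner ℝ c z.1 - z.2)| ≤ ε := by
  have hnorm := norm_le_sum_abs z.1
  have hM := firstMoment_nonneg DX DY
  have hK : 0 ≤ 3750 * firstMoment DX DY * m := by positivity
  unfold pointSize at hz
  have hmem : ∀ u : EuclideanSpace ℝ (Fin d), ‖u‖ ≤ W →
      inner ℝ u z.1 - z.2 ∈ Set.Icc (-radius DX DY W m) (radius DX DY W m) := by
    intro u hu
    rw [Set.mem_Icc, ← abs_le, radius]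
    have h1 : |inner ℝ u z.1| ≤ W * ‖z.1‖ :=
      (abs_real_inner_le_norm u z.1).trans (by gcongr)
    have h2 := abs_sub (inner ℝ u z.1) z.2
    have h3 : W * ‖z.1‖ ≤ W * (3750 * firstMoment DX DY * m) := by
      gcongr
      linarith [abs_nonneg z.2]
    have h4 : |z.2| ≤ 3750 * firstMoment DX DY * m := by linarith [norm_nonneg z.1]
    nlinarith [mul_nonneg hW.le hK]
  refine abs_sub_le_of_le_modulus hℓ hε (hmem w hw) (hmem c hc)
    ((ENNReal.ofReal_le_ofReal ?_).trans (ofReal_netScale_mul_le DX DY m ℓ W ε))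
  rw [sub_sub_sub_cancel_right, ← inner_sub_left]
  refine (abs_real_inner_le_norm _ _).trans (mul_le_mul hwc ?_ (norm_nonneg _)
    (netScale_nonneg DX DY m))
  linarith [abs_nonneg z.2]

/-- The blocks of `m` points whose total size exceeds `3750` times its mean. -/
def heavyBlocks {d : ℕ} (DX : Measure (EuclideanSpace ℝ (Fin d))) (DY : Measure ℝ) (m : ℕ) :
    Set (Fin m → EuclideanSpace ℝ (Fin d) × ℝ) :=
  {x | 3750 * firstMoment DX DY * m < ∑ j, pointSize (x j)}

theorem measurableSet_heavyBlocks {d : ℕ} (DX : Measure (EuclideanSpace ℝ (Fin d)))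
    (DY : Measure ℝ) (m : ℕ) : MeasurableSet (heavyBlocks DX DY m) :=
  measurableSet_lt measurable_const
    (Finset.measurable_sum _ fun j _ => measurable_pointSize.comp (measurable_pi_apply j))

/-- Markov's inequality. It needs a separate argument if the first moment vanishes: then almost
every block has size zero. -/
theorem measureReal_heavyBlocks_le {d : ℕ} (DX : Measure (EuclideanSpace ℝ (Fin d)))
    [IsProbabilityMeasure DX] (DY : Measure ℝ) [IsProbabilityMeasure DY]
    (hX : Integrable (fun x : EuclideanSpace ℝ (Fin d) => ∑ i, |x i|) DX)
    (hY : Integrable (fun y : ℝ => |y|) DY) (m : ℕ) :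
    (Measure.pi fun _ : Fin m => DX.prod DY).real (heavyBlocks DX DY m) ≤ 1 / 3750 := by
  set Q : Measure (Fin m → EuclideanSpace ℝ (Fin d) × ℝ) := Measure.pi fun _ => DX.prod DY with hQ
  set K : ℝ := firstMoment DX DY * m with hK
  have hpt : Integrable (pointSize : EuclideanSpace ℝ (Fin d) × ℝ → ℝ) (DX.prod DY) :=
    (hX.comp_fst DY).add (hY.comp_snd DX)
  have hptE : ∫ z, pointSize z ∂(DX.prod DY) = firstMoment DX DY := by
    simp only [pointSize, firstMoment]
    rw [integral_add (hX.comp_fst DY) (hY.comp_snd DX),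
      integral_fun_fst (fun x : EuclideanSpace ℝ (Fin d) => ∑ i, |x i|),
      integral_fun_snd (fun y : ℝ => |y|)]
    simp
  have hcoord : ∀ j : Fin m, Integrable (fun x => pointSize (x j)) Q := fun j =>
    (measurePreserving_eval (fun _ : Fin m => DX.prod DY) j).integrable_comp_of_integrable hpt
  have hint : Integrable (fun x => ∑ j, pointSize (x j)) Q :=
    integrable_finsetSum _ fun j _ => hcoord j
  have hE : ∫ x, ∑ j, pointSize (x j) ∂Q = K := by
    have : ∀ j : Fin m, ∫ x, pointSize (x j) ∂Q = firstMoment DX DY := fun j => by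
      have h := (measurePreserving_eval (fun _ : Fin m => DX.prod DY) j)
      rw [← hptE, ← h.map_eq, integral_map h.measurable.aemeasurable
        measurable_pointSize.aestronglyMeasurable]
    rw [integral_finsetSum _ fun j _ => hcoord j]
    simp [this, hK, mul_comm]
  have hnn : ∀ x : Fin m → EuclideanSpace ℝ (Fin d) × ℝ, 0 ≤ ∑ j, pointSize (x j) :=
    fun x => Finset.sum_nonneg fun _ _ => pointSize_nonneg _
  have hK0 : 0 ≤ K := mul_nonneg (firstMoment_nonneg DX DY) m.cast_nonneg
  rcases hK0.eq_or_lt with h0 | hpos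
  · have hae := (integral_eq_zero_iff_of_nonneg hnn hint).1 (hE.trans h0.symm)
    have hnull : Q (heavyBlocks DX DY m) = 0 := by
      refine measure_mono_null (fun x hx => ?_) hae
      have hx' : 3750 * firstMoment DX DY * m < ∑ j, pointSize (x j) := hx
      rw [mul_assoc, ← hK, ← h0, mul_zero] at hx'
      exact hx'.ne'
    rw [Measure.real, hnull]
    norm_num
  · have hmarkov := mul_meas_ge_le_integral_of_nonneg (μ := Q) (Filter.Eventually.of_forall hnn)
      hint (3750 * K)
    rw [hE] at hmarkov
    have hmono : Q.real (heavyBlocks DX DY m) ≤ Q.real {x | 3750 * K ≤ ∑ j, pointSize (x j)} := by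
      refine measureReal_mono fun x hx => ?_
      have hx' : 3750 * firstMoment DX DY * m < ∑ j, pointSize (x j) := hx
      rw [mul_assoc] at hx'
      exact hx'.le
    rw [le_div_iff₀ (by norm_num)]
    refine le_of_mul_le_mul_left ?_ hpos
    nlinarith

/-- A net of weight vectors gives a finite subclass, independent of the sample, that approximates
the whole class on every block that is not heavy. -/
theorem exists_finite_approximation {d : ℕ} {ℓ : ℝ → ℝ} (hℓ : Continuous ℓ)
    (DX : Measure (EuclideanSpace ℝ (Fin d))) (DY : Measure ℝ) {W ε : ℝ} {m : ℕ}
    (hW : 0 < W) (hε : 0 < ε) (hm : 1 ≤ m) :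
    ∃ G : Finset (EuclideanSpace ℝ (Fin d) × ℝ → ℝ), ↑G ⊆ regressionClass (d := d) ℓ W ∧
      (G.card : ℝ) ≤ sizeBound ℓ DX DY W ε m ∧
      ∀ f ∈ regressionClass ℓ W, ∃ g ∈ G, ∀ x ∉ heavyBlocks DX DY m,
        ∑ j, |(f (x j) - g (x j)) / m| ≤ ε := by
  classical
  have hβ := netScale_pos (ℓ := ℓ) DX DY m hℓ hW hε
  have hβW := netScale_le (ℓ := ℓ) (ε := ε) DX DY m hW
  obtain ⟨s, hsW, hnet, hcard⟩ := exists_net (E := EuclideanSpace ℝ (Fin d)) hW hβ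
  set β := netScale ℓ DX DY W ε m with hβdef
  refine ⟨s.image fun w z => ℓ (inner ℝ w z.1 - z.2), ?_, ?_, ?_⟩
  · intro f hf
    obtain ⟨w, hw, rfl⟩ := Finset.mem_image.1 (Finset.mem_coe.1 hf)
    exact ⟨w, hsW w hw, rfl⟩
  · refine (Nat.cast_le.2 Finset.card_image_le).trans (hcard.trans ?_)
    rw [finrank_euclideanSpace_fin, sizeBound, ← hβdef]
    refine pow_le_pow_left₀ (by positivity) ?_ d
    rw [div_add_one hβ.ne']
    gcongr
    linarith
  · rintro f ⟨w, hw, rfl⟩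
    obtain ⟨c, hc, hwc⟩ := hnet w hw
    refine ⟨_, Finset.mem_image_of_mem _ hc, fun x hx => ?_⟩
    have hm0 : (0 : ℝ) < m := by exact_mod_cast hm
    have hx' : ∑ j, pointSize (x j) ≤ 3750 * firstMoment DX DY * m := not_lt.1 hx
    calc _ ≤ ∑ j : Fin m, ε / m := by
          refine Finset.sum_le_sum fun j _ => ?_
          rw [abs_div, abs_of_pos hm0]
          gcongr
          exact abs_regression_sub_le hℓ DX DY hW hε.le hw (hsW c hc) hwc
            ((Finset.single_le_sum (fun i _ => pointSize_nonneg (x i))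
              (Finset.mem_univ j)).trans hx')
      _ = ε := by
          simp only [Finset.sum_const, Finset.card_univ, Fintype.card_fin, nsmul_eq_mul]
          field_simp

/-! ### Discretization -/

open Classical in
/-- The samples of `κ` blocks at least `c` of which lie in `S`. -/
def manyBlocksIn {Ω : Type*} (S : Set Ω) (κ : ℕ) (c : ℝ) : Set (Fin κ → Ω) :=
  {ω | c ≤ ((Finset.univ.filter fun i => ω i ∈ S).card : ℝ)}

theorem measurableSet_manyBlocksIn {Ω : Type*} [MeasurableSpace Ω] {S : Set Ω}
    (hS : MeasurableSet S) (κ : ℕ) (c : ℝ) : MeasurableSet (manyBlocksIn S κ c) := by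
  classical
  have h : Measurable fun ω : Fin κ → Ω => ∑ i, S.indicator (fun _ => (1 : ℝ)) (ω i) :=
    Finset.measurable_sum _ fun i _ =>
      (measurable_const.indicator hS).comp (measurable_pi_apply i)
  convert measurableSet_le (measurable_const (a := c)) h using 1
  ext ω
  simp only [manyBlocksIn, Set.mem_ofPred_eq, Set.indicator_apply, Finset.sum_boole]

theorem probAtLeast_of_compl {Ω : Type*} [MeasurableSpace Ω] {P : Measure Ω}
    [IsProbabilityMeasure P] {δ : ℝ} {A B : Set Ω} (hB : MeasurableSet B)
    (hBδ : P.real B ≤ δ) (hBA : Bᶜ ⊆ A) : ProbAtLeast P (1 - δ) A := by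
  refine ⟨Bᶜ, hBA, hB.compl, ?_⟩
  rw [← ofReal_measureReal, measureReal_compl hB]
  refine ENNReal.ofReal_le_ofReal ?_
  simp only [probReal_univ]
  linarith

/-- The fraction `2 / 1875` is four times the bound `1 / 3750` on the probability of a heavy block,
and three times `2 / 1875` is the fraction `2 / 625` of blocks that a discretization may ignore on
three samples together. -/
theorem measureReal_manyBlocksIn_heavyBlocks_le {d : ℕ}
    (DX : Measure (EuclideanSpace ℝ (Fin d)))
    [IsProbabilityMeasure DX] (DY : Measure ℝ) [IsProbabilityMeasure DY]
    (hX : Integrable (fun x : EuclideanSpace ℝ (Fin d) => ∑ i, |x i|) DX)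
    (hY : Integrable (fun y : ℝ => |y|) DY) (m κ : ℕ) {δ : ℝ} (hδ0 : 0 < δ) (hδ1 : δ < 1)
    (hκ : threshold δ ≤ κ) :
    (sampleLaw (DX.prod DY) m κ).real
      (manyBlocksIn (heavyBlocks DX DY m) κ (2 * κ / 1875)) ≤ δ / 3 := by
  refine (measureReal_le_card_le_exp _ (measurableSet_heavyBlocks DX DY m)
    (measureReal_heavyBlocks_le DX DY hX hY m) κ _).trans ?_
  have hlog : Real.log (Real.exp 1 / δ) = 1 - Real.log δ := by
    rw [Real.log_div (Real.exp_pos 1).ne' hδ0.ne', Real.log_exp]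
  have hneg : Real.log δ < 0 := Real.log_neg hδ0 hδ1
  rw [threshold, hlog] at hκ
  have h3 : Real.exp (-2) ≤ 1 / 3 := by
    rw [Real.exp_neg, ← one_div]
    exact one_div_le_one_div_of_le (by norm_num) (by linarith [Real.add_one_le_exp (2 : ℝ)])
  calc _ ≤ Real.exp (Real.log δ + -2) := Real.exp_le_exp.2 (by linarith)
    _ = δ * Real.exp (-2) := by rw [Real.exp_add, Real.exp_log hδ0]
    _ ≤ δ / 3 := by nlinarith

/-- The ignored blocks are those that are heavy in at least one of the three samples. -/
theorem admitsDiscretization_regressionClass {d : ℕ} {ℓ : ℝ → ℝ} (hℓ : Continuous ℓ) {W : ℝ}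
    (hW : 0 < W) (DX : Measure (EuclideanSpace ℝ (Fin d))) [IsProbabilityMeasure DX]
    (DY : Measure ℝ) [IsProbabilityMeasure DY]
    (hX : Integrable (fun x : EuclideanSpace ℝ (Fin d) => ∑ i, |x i|) DX)
    (hY : Integrable (fun y : ℝ => |y|) DY) :
    AdmitsDiscretization (regressionClass ℓ W) (DX.prod DY) threshold ⊤
      (sizeBound ℓ DX DY W) := by
  classical
  refine ⟨ENNReal.zero_lt_top, fun ε δ m κ hε _ hδ0 hδ1 hm hκ => ?_⟩
  obtain ⟨G, -, hcard, happrox⟩ := exists_finite_approximation hℓ DX DY hW hε hm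
  set H := manyBlocksIn (heavyBlocks DX DY m) κ (2 * κ / 1875) with hH
  have hHm : MeasurableSet H := measurableSet_manyBlocksIn (measurableSet_heavyBlocks DX DY m) κ _
  have hHδ := measureReal_manyBlocksIn_heavyBlocks_le DX DY hX hY m κ hδ0 hδ1 hκ
  refine probAtLeast_of_compl (B := ⋃ l : Fin 3, Function.eval l ⁻¹' H)
    (MeasurableSet.iUnion fun l => measurable_pi_apply l hHm) ?_ fun X hX => ?_
  · refine (measureReal_iUnion_fintype_le _).trans ?_
    have : ∀ l : Fin 3, (Measure.pi fun _ : Fin 3 => sampleLaw (DX.prod DY) m κ).real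
        (Function.eval l ⁻¹' H) ≤ δ / 3 := fun l => by
      rw [(measurePreserving_eval (fun _ : Fin 3 => sampleLaw (DX.prod DY) m κ)
        l).measureReal_preimage hHm.nullMeasurableSet]
      exact hHδ
    refine (Finset.sum_le_sum fun l _ => this l).trans ?_
    simp only [Finset.sum_const, Finset.card_univ, Fintype.card_fin, nsmul_eq_mul]
    push_cast
    linarith
  · refine ⟨G, fun f hf => ?_, G.finite_toSet, by rwa [Set.ncard_coe_finset]⟩
    obtain ⟨g, hg, hfg⟩ := happrox f hf
    refine ⟨g, hg, Finset.univ.biUnion fun l : Fin 3 =>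
      Finset.univ.filter fun i => X l i ∈ heavyBlocks DX DY m, ?_, fun i hi l => hfg _ ?_⟩
    · have hl : ∀ l : Fin 3, ((Finset.univ.filter fun i =>
          X l i ∈ heavyBlocks DX DY m).card : ℝ) ≤ 2 * κ / 1875 := fun l => by
        by_contra hcon
        refine hX (Set.mem_iUnion.2 ⟨l, ?_⟩)
        simp only [H, manyBlocksIn, Set.mem_preimage, Set.mem_ofPred_eq, Function.eval]
        convert (not_le.1 hcon).le
      calc _ ≤ ∑ l : Fin 3, ((Finset.univ.filter fun i =>
            X l i ∈ heavyBlocks DX DY m).card : ℝ) := by exact_mod_cast Finset.card_biUnion_le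
        _ ≤ ∑ l : Fin 3, 2 * (κ : ℝ) / 1875 := Finset.sum_le_sum fun l _ => hl l
        _ = 2 * κ / 625 := by
          simp only [Finset.sum_const, Finset.card_univ, Fintype.card_fin, nsmul_eq_mul]
          push_cast
          ring
    · simp only [Finset.mem_biUnion, Finset.mem_filter, Finset.mem_univ, true_and,
        not_exists] at hi
      exact hi l

/-! ### Concentration of the median of means -/

theorem measurable_of_mem_regressionClass {d : ℕ} {ℓ : ℝ → ℝ} (hℓ : Continuous ℓ) {W : ℝ}
    {f : EuclideanSpace ℝ (Fin d) × ℝ → ℝ} (hf : f ∈ regressionClass ℓ W) : Measurable f := by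
  obtain ⟨w, -, rfl⟩ := hf
  have : Continuous fun z : EuclideanSpace ℝ (Fin d) × ℝ => ℓ (inner ℝ w z.1 - z.2) := by
    fun_prop
  exact this.measurable

theorem SubsetLp.memLp {𝒳 : Type*} [MeasurableSpace 𝒳] {ℱ : Set (𝒳 → ℝ)} {p : ℝ}
    {D : Measure 𝒳} (hp : 0 < p) (h : SubsetLp ℱ p D) {f : 𝒳 → ℝ} (hf : f ∈ ℱ) :
    MemLp f (ENNReal.ofReal p) D := by
  have hp0 : ENNReal.ofReal p ≠ 0 := (ENNReal.ofReal_pos.2 hp).ne'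
  rw [← integrable_norm_rpow_iff (h.1 f hf) hp0 ENNReal.ofReal_ne_top,
    ENNReal.toReal_ofReal hp.le]
  refine ⟨((h.1 f hf).norm.aemeasurable.pow_const p).aestronglyMeasurable, ?_⟩
  rw [hasFiniteIntegral_iff_ofReal (Filter.Eventually.of_forall fun z => by positivity)]
  exact lt_of_le_of_lt (le_iSup₂ (f := fun f (_ : f ∈ ℱ) =>
    ∫⁻ z, ENNReal.ofReal (|f z| ^ p) ∂D) f hf) h.2

theorem measurable_sampleMean {𝒳 : Type*} [MeasurableSpace 𝒳] {f : 𝒳 → ℝ} (hf : Measurable f)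
    (m : ℕ) : Measurable (sampleMean f : (Fin m → 𝒳) → ℝ) :=
  (Finset.measurable_sum _ fun j _ => hf.comp (measurable_pi_apply j)).div_const _

theorem abs_sampleMean_sub_le {𝒳 : Type*} {m : ℕ} (f g : 𝒳 → ℝ) (x : Fin m → 𝒳) :
    |sampleMean f x - sampleMean g x| ≤ ∑ j, |(f (x j) - g (x j)) / m| := by
  rw [sampleMean, sampleMean, ← sub_div, ← Finset.sum_sub_distrib, Finset.sum_div]
  exact Finset.abs_sum_le_sum_abs _ _

/-- The blocks on which the sample mean of `f` is off by more than `t`. -/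
def deviantBlocks {𝒳 : Type*} [MeasurableSpace 𝒳] (D : Measure 𝒳) (m : ℕ) (t : ℝ) (f : 𝒳 → ℝ) :
    Set (Fin m → 𝒳) :=
  {x | t < |sampleMean f x - ∫ z, f z ∂D|}

theorem measurableSet_deviantBlocks {𝒳 : Type*} [MeasurableSpace 𝒳] (D : Measure 𝒳) (m : ℕ)
    (t : ℝ) {f : 𝒳 → ℝ} (hf : Measurable f) : MeasurableSet (deviantBlocks D m t f) :=
  measurableSet_lt measurable_const ((measurable_sampleMean hf m).sub_const _).abs

/-- The lower bound on `m` allows the weak law to be applied with `ρ = 1 / 400`. -/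
theorem measureReal_deviantBlocks_le {𝒳 : Type*} [MeasurableSpace 𝒳] {D : Measure 𝒳}
    [IsProbabilityMeasure D] {ℱ : Set (𝒳 → ℝ)} {p v ε : ℝ} {m : ℕ} {f : 𝒳 → ℝ} (hfm : Measurable f)
    (hp1 : 1 < p) (hp2 : p ≤ 2) (hLp : SubsetLp ℱ p D) (hf : f ∈ ℱ)
    (hv : ∫ z, |f z - ∫ z', f z' ∂D| ^ p ∂D ≤ v) (hε : 0 < ε) (hm : 1 ≤ m)
    (hmv : (400 * 16 ^ p * v / ε ^ p) ^ (1 / (p - 1)) ≤ (m : ℝ)) :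
    (Measure.pi fun _ : Fin m => D).real (deviantBlocks D m (ε / 16) f) ≤ 3 / 400 := by
  have hp0 : 0 < p := by linarith
  have hmem := hLp.memLp hp0 hf
  have hpint : Integrable (fun z => |f z - ∫ z', f z' ∂D| ^ p) D := by
    have h := (hmem.sub (memLp_const (∫ z', f z' ∂D))).integrable_norm_rpow
      (ENNReal.ofReal_pos.2 hp0).ne' ENNReal.ofReal_ne_top
    simpa [ENNReal.toReal_ofReal hp0.le] using h
  have hfint : Integrable f D :=
    hmem.integrable (by rw [← ENNReal.ofReal_one]; exact ENNReal.ofReal_le_ofReal hp1.le)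
  have hv0 : 0 ≤ v := (integral_nonneg fun z => by positivity).trans hv
  have hpow : 400 * 16 ^ p * v / ε ^ p ≤ (m : ℝ) ^ (p - 1) := by
    have h := Real.rpow_le_rpow (by positivity) hmv (by linarith : 0 ≤ p - 1)
    rwa [← Real.rpow_mul (by positivity), one_div_mul_cancel (by linarith), Real.rpow_one] at h
  have h := measureReal_sampleMean_deviation_le D hfm hfint (t := ε / 16) (ρ := 1 / 400) hp1 hp2
    hpint hv (by positivity) hm (by norm_num) ?_
  · exact h.trans (by norm_num)
  · rw [Real.div_rpow hε.le (by norm_num)]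
    rw [div_le_iff₀ (by positivity)] at hpow
    have h16 : (0 : ℝ) < 16 ^ p := by positivity
    rw [one_div_mul_eq_div, le_div_iff₀ (by norm_num), div_mul_eq_mul_div, le_div_iff₀ h16]
    linarith

/-- Functions whose sample means are close on most blocks have close means: some block is
representative for both. -/
theorem abs_integral_sub_integral_le {𝒳 : Type*} [MeasurableSpace 𝒳] {D : Measure 𝒳}
    [IsProbabilityMeasure D] {m : ℕ} {t q : ℝ} {f g : 𝒳 → ℝ} {S : Set (Fin m → 𝒳)}
    (hS : (Measure.pi fun _ : Fin m => D).real S ≤ q)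
    (hf : (Measure.pi fun _ : Fin m => D).real (deviantBlocks D m t f) ≤ q)
    (hg : (Measure.pi fun _ : Fin m => D).real (deviantBlocks D m t g) ≤ q) (hq : 3 * q < 1)
    (hfg : ∀ x ∉ S, |sampleMean f x - sampleMean g x| ≤ t) :
    |∫ z, f z ∂D - ∫ z, g z ∂D| ≤ 3 * t := by
  obtain ⟨x, hx⟩ : ∃ x, x ∉ S ∪ (deviantBlocks D m t f ∪ deviantBlocks D m t g) := by
    by_contra! hcon
    have huniv := Set.eq_univ_of_forall hcon
    have h1 := measureReal_union_le (μ := Measure.pi fun _ : Fin m => D) S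
      (deviantBlocks D m t f ∪ deviantBlocks D m t g)
    have h2 := measureReal_union_le (μ := Measure.pi fun _ : Fin m => D)
      (deviantBlocks D m t f) (deviantBlocks D m t g)
    rw [huniv, probReal_univ] at h1
    linarith
  simp only [deviantBlocks, Set.mem_union, Set.mem_ofPred_eq, not_or, not_lt] at hx
  have h1 := abs_le.1 (hfg x hx.1)
  have h2 := abs_le.1 hx.2.1
  have h3 := abs_le.1 hx.2.2
  rw [abs_le]
  constructor <;> linarith [h1.1, h1.2, h2.1, h2.2, h3.1, h3.2]

/-- Outside an event of probability `δ`, few blocks are heavy and, for each member of the finite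
approximating class, few blocks are deviant. Then most block means of every `f` in the class are
within `5 ε / 16` of the mean, and so is the median. -/
theorem probAtLeast_abs_mom_sub_integral_le {d : ℕ} {ℓ : ℝ → ℝ} (hℓ : Continuous ℓ) {W : ℝ}
    (hW : 0 < W) (DX : Measure (EuclideanSpace ℝ (Fin d))) [IsProbabilityMeasure DX]
    (DY : Measure ℝ) [IsProbabilityMeasure DY]
    (hX : Integrable (fun x : EuclideanSpace ℝ (Fin d) => ∑ i, |x i|) DX)
    (hY : Integrable (fun y : ℝ => |y|) DY) {p v : ℝ} (hp_gt : 1 < p) (hp_le : p ≤ 2)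
    (hLp : SubsetLp (regressionClass ℓ W) p (DX.prod DY))
    (hv : ∀ f ∈ regressionClass (d := d) ℓ W,
      ∫ z, |f z - ∫ z', f z' ∂(DX.prod DY)| ^ p ∂(DX.prod DY) ≤ v)
    {ε δ : ℝ} {m κ : ℕ} (hε : 0 < ε) (hδ0 : 0 < δ) (hδ1 : δ < 1) (hm : 1 ≤ m)
    (hmv : (400 * 16 ^ p * v / ε ^ p) ^ (1 / (p - 1)) ≤ (m : ℝ))
    (hκ0 : (0 : ℝ) < κ) (hκ1 : threshold (δ / 8) ≤ κ)
    (hκ3 : 50 * Real.log (8 * sizeBound ℓ DX DY W (ε / 16) m / δ) ≤ κ) :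
    ProbAtLeast (sampleLaw (DX.prod DY) m κ) (1 - δ)
      {Z | ∀ f ∈ regressionClass ℓ W, |mom f Z - ∫ z, f z ∂(DX.prod DY)| ≤ ε} := by
  classical
  set D := DX.prod DY with hD
  set N := sizeBound ℓ DX DY W (ε / 16) m with hN
  obtain ⟨G, hGsub, hcard, happrox⟩ :=
    exists_finite_approximation hℓ DX DY hW (by positivity : 0 < ε / 16) hm
  have hdev : ∀ f ∈ regressionClass ℓ W, (Measure.pi fun _ : Fin m => D).real
      (deviantBlocks D m (ε / 16) f) ≤ 3 / 400 := fun f hf =>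
    measureReal_deviantBlocks_le (measurable_of_mem_regressionClass hℓ hf) hp_gt hp_le hLp hf
      (hv f hf) hε hm hmv
  have hdevm : ∀ g ∈ G, MeasurableSet (deviantBlocks D m (ε / 16) g) := fun g hg =>
    measurableSet_deviantBlocks D m _ (measurable_of_mem_regressionClass hℓ (hGsub hg))
  have hmean : ∀ f ∈ regressionClass ℓ W, ∃ g ∈ G,
      (∀ x ∉ heavyBlocks DX DY m, |sampleMean f x - sampleMean g x| ≤ ε / 16) ∧
      |∫ z, f z ∂D - ∫ z, g z ∂D| ≤ 3 * (ε / 16) := by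
    intro f hf
    obtain ⟨g, hg, hfg⟩ := happrox f hf
    have hfg' : ∀ x ∉ heavyBlocks DX DY m, |sampleMean f x - sampleMean g x| ≤ ε / 16 :=
      fun x hx => (abs_sampleMean_sub_le f g x).trans (hfg x hx)
    exact ⟨g, hg, hfg', abs_integral_sub_integral_le
      ((measureReal_heavyBlocks_le DX DY hX hY m).trans (by norm_num)) (hdev f hf)
      (hdev g (hGsub hg)) (by norm_num) hfg'⟩
  -- The class contains `w = 0`, so `G` is not empty.
  have hN0 : 0 < N := by
    obtain ⟨g, hg, -⟩ := happrox _ ⟨0, by simpa using hW.le, rfl⟩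
    exact lt_of_lt_of_le (by exact_mod_cast Finset.card_pos.2 ⟨g, hg⟩) hcard
  -- The two fractions add up to less than `1 / 2`, which the median tolerates.
  refine probAtLeast_of_compl (B := manyBlocksIn (heavyBlocks DX DY m) κ (2 * κ / 1875) ∪
    ⋃ g ∈ G, manyBlocksIn (deviantBlocks D m (ε / 16) g) κ (2 * κ / 5)) ?_ ?_ ?_
  · exact (measurableSet_manyBlocksIn (measurableSet_heavyBlocks DX DY m) κ _).union
      (Finset.measurableSet_biUnion G fun g hg => measurableSet_manyBlocksIn (hdevm g hg) κ _)
  · have h1 := measureReal_manyBlocksIn_heavyBlocks_le DX DY hX hY m κ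
      (by positivity : 0 < δ / 8) (by linarith) hκ1
    have h2 : ∀ g ∈ G, (sampleLaw D m κ).real
        (manyBlocksIn (deviantBlocks D m (ε / 16) g) κ (2 * κ / 5)) ≤ δ / (8 * N) := by
      intro g hg
      refine (measureReal_le_card_le_exp _ (hdevm g hg) (hdev g (hGsub hg)) κ _).trans ?_
      calc _ ≤ Real.exp (-Real.log (8 * N / δ)) := Real.exp_le_exp.2 (by linarith)
        _ = δ / (8 * N) := by rw [Real.exp_neg, Real.exp_log (by positivity), inv_div]
    have h3 : (G.card : ℝ) * (δ / (8 * N)) ≤ δ / 8 := by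
      calc _ ≤ N * (δ / (8 * N)) := by gcongr
        _ = δ / 8 := by field_simp
    have h4 := (measureReal_biUnion_finset_le (μ := sampleLaw D m κ) G fun g =>
      manyBlocksIn (deviantBlocks D m (ε / 16) g) κ (2 * κ / 5)).trans (Finset.sum_le_sum h2)
    rw [Finset.sum_const, nsmul_eq_mul] at h4
    refine (measureReal_union_le _ _).trans ?_
    linarith
  · intro Z hZ f hf
    obtain ⟨g, hg, hfg, hμ⟩ := hmean f hf
    simp only [Set.mem_compl_iff, Set.mem_union, Set.mem_iUnion, not_or, not_exists] at hZ
    have hH := hZ.1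
    have hV := hZ.2 g hg
    simp only [manyBlocksIn, Set.mem_ofPred_eq, not_le] at hH hV
    refine abs_median_sub_le (by exact_mod_cast hκ0) _ _ _
      ((Finset.univ.filter fun i => Z i ∈ heavyBlocks DX DY m) ∪
        Finset.univ.filter fun i => Z i ∈ deviantBlocks D m (ε / 16) g) ?_ fun i hi => ?_
    · have h := Finset.card_union_le (Finset.univ.filter fun i => Z i ∈ heavyBlocks DX DY m)
        (Finset.univ.filter fun i => Z i ∈ deviantBlocks D m (ε / 16) g)
      have h' : (((Finset.univ.filter fun i => Z i ∈ heavyBlocks DX DY m) ∪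
        Finset.univ.filter fun i => Z i ∈ deviantBlocks D m (ε / 16) g).card : ℝ) ≤
        ((Finset.univ.filter fun i => Z i ∈ heavyBlocks DX DY m).card : ℝ) +
        ((Finset.univ.filter fun i => Z i ∈ deviantBlocks D m (ε / 16) g).card : ℝ) := by
        exact_mod_cast h
      have : (2 : ℝ) * (((Finset.univ.filter fun i => Z i ∈ heavyBlocks DX DY m) ∪
        Finset.univ.filter fun i => Z i ∈ deviantBlocks D m (ε / 16) g).card : ℝ) < κ := by
        linarith
      exact_mod_cast this
    · simp only [Finset.mem_union, Finset.mem_filter, Finset.mem_univ, true_and, not_or] at hi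
      have h1 := abs_le.1 (hfg _ hi.1)
      have h2 : |sampleMean g (Z i) - ∫ z, g z ∂D| ≤ ε / 16 := not_lt.1 hi.2
      rw [abs_le] at h2
      have h3 := abs_le.1 hμ
      rw [abs_le]
      constructor <;> linarith [h1.1, h1.2, h2.1, h2.2, h3.1, h3.2]

end MedianOfMeans

theorem theorem3 (d : ℕ) (ℓ : ℝ → ℝ) (hℓ : Continuous ℓ) (hℓ_nonneg : ∀ t, 0 ≤ ℓ t)
    (W : ℝ) (hW : 0 < W)
    (DX : Measure (EuclideanSpace ℝ (Fin d))) [IsProbabilityMeasure DX]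
    (DY : Measure ℝ) [IsProbabilityMeasure DY]
    (hX : Integrable (fun x : EuclideanSpace ℝ (Fin d) => ∑ i, |x i|) DX)
    (hY : Integrable (fun y : ℝ => |y|) DY)
    (p : ℝ) (hp_gt : 1 < p) (hp_le : p ≤ 2)
    (hLp : MedianOfMeans.SubsetLp (MedianOfMeans.regressionClass ℓ W) p (DX.prod DY))
    (v : ℝ)
    (hv : ∀ f ∈ MedianOfMeans.regressionClass (d := d) ℓ W,
      ∫ z, |f z - ∫ z', f z' ∂(DX.prod DY)| ^ p ∂(DX.prod DY) ≤ v) :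
    MedianOfMeans.AdmitsDiscretization (MedianOfMeans.regressionClass ℓ W) (DX.prod DY)
      MedianOfMeans.threshold ⊤ (MedianOfMeans.sizeBound ℓ DX DY W) ∧
    ∀ (ε δ : ℝ) (m κ : ℕ), 0 < ε → 0 < δ → δ < 1 → 1 ≤ m →
      (400 * 16 ^ p * v / ε ^ p) ^ (1 / (p - 1)) ≤ (m : ℝ) →
      max (MedianOfMeans.threshold (δ / 8)) (max (10 ^ 6 * Real.log 2 / 99)
        (50 * Real.log (8 * MedianOfMeans.sizeBound ℓ DX DY W (ε / 16) m / δ))) ≤ (κ : ℝ) →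
      MedianOfMeans.ProbAtLeast (MedianOfMeans.sampleLaw (DX.prod DY) m κ) (1 - δ)
        {Z | ∀ f ∈ MedianOfMeans.regressionClass ℓ W,
          |MedianOfMeans.mom f Z - ∫ z, f z ∂(DX.prod DY)| ≤ ε} := by
  refine ⟨MedianOfMeans.admitsDiscretization_regressionClass hℓ hW DX DY hX hY, ?_⟩
  intro ε δ m κ hε hδ0 hδ1 hm hmv hκ
  obtain ⟨hκ1, hκ23⟩ := max_le_iff.1 hκ
  obtain ⟨hκ2, hκ3⟩ := max_le_iff.1 hκ23
  have hκ0 : (0 : ℝ) < κ := lt_of_lt_of_le (by have := Real.log_pos one_lt_two; positivity) hκ2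
  exact MedianOfMeans.probAtLeast_abs_mom_sub_integral_le hℓ hW DX DY hX hY hp_gt hp_le hLp hv
    hε hδ0 hδ1 hm hmv hκ0 hκ1 hκ3
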